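/- **Setting.** Let $\mathbb{K}$ be $\mathbb{R}$ or $\mathbb{C}$ and let $V$ be a Hausdorff topological vector space over $\mathbb{K}$. For $n\ge 1$ let $\operatorname{Hom}(V^{\otimes n},V)$ be the topological vector space of continuous $n$-linear maps $V^n\to V$ with the topology of pointwise convergence, let $f\circ_i g$ be the insertion of $g$ in the $i$-th argument of $f$, and let $F(n,\mathbb{C})$ be the space of $n$-tuples of distinct points of $\mathbb{C}$. A map from $F(n,\mathbb{C})$ to a topological vector space is smooth if its iterated real directional derivatives of all orders exist and are jointly continuous in the point and the directions. **The operad $\underline{\mathcal M}$.** For $n\geq 1$ let $\underline{\mathcal M}(n)$ be the (Fulton–MacPherson/Axelrod–Singer) compactification of $\mathcal M(n)=F(n,\mathbb{C})/(\text{translations and positive dilations})$, that is, the closure of the image of $F(n,\mathbb{C})$ in $\prod_{j\ne k}S^1\times\prod_{j\neq k\neq l\neq j}[0,\infty]$ under the map with coordinates $\frac{z_j-z_k}{|z_j-z_k|}$ and $\frac{|z_j-z_k|}{|z_j-z_l|}$, which embeds $\mathcal M(n)$ as the open stratum. The symmetric group $S_n$ acts by relabelling. The composition $x\circ_i y\in\underline{\mathcal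 M}(p+q-1)$ of $x\in\underline{\mathcal M}(p)$ and $y\in\underline{\mathcal M}(q)$ inserts $y$, infinitesimally small, at the $i$-th point of $x$: directions and ratios among points of $y$ are those of $y$, all others are those of $x$ with every point of $y$ placed at the $i$-th point (the ratio of a distance between points of $y$ to the distance from one of them to a point not of $y$ is $0$). For configurations this is the limit, as $\varepsilon\to0^+$, of replacing the point $z_i$ by the points $z_i+\varepsilon w_b$. The unit is the point of $\underline{\mathcal M}(1)$. **Reduced CFT.** A *reduced conformal field theory* structure on $V$ is a family of smooth maps $\Psi_n:F(n,\mathbb{C})\to\operatorname{Hom}(V^{\otimes n},V)$, $n\geq1$, $(z_1,\dots,z_n)\mapsto\Psi_{(z_1,\dots,z_n)}$, such that 1. $\Psi_{(z_{\sigma(1)},\dots,z_{\sigma(n)})}(v_{\sigma(1)},\dots,v_{\sigma(n)})=\Psi_{(z_1,\dots,z_n)}(v_1,\dots,v_n)$ for all $\sigma\in S_n$; 2. $\Psi_{(az_1+b,\dots,az_n+b)}=\Psi_{(z_1,\dots,z_n)}$ for all $a>0$ and $b\in\mathbb{C}$; 3. as $(z_1,\dots,z_n)$ approaches in $\underline{\mathcal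 M}(n)$ a composition of configurations, $\Psi_{(z_1,\dots,z_n)}(v_1,\dots,v_n)$ converges to the value at $(v_1,\dots,v_n)$ of the corresponding composition of operators, for all $v_1,\dots,v_n\in V$; here compositions are iterated $\circ_i$-compositions of any number of configurations. In the case of two configurations: as $(z_1,\dots,z_n)\to(t_1,\dots,t_p)\circ_i(w_1,\dots,w_{n-p+1})$, $$\Psi_{(z_1,\dots,z_n)}(v_1,\dots,v_n)\to\Psi_{(t_1,\dots,t_p)}(v_1,\dots,v_{i-1},\Psi_{(w_1,\dots,w_{n-p+1})}(v_i,\dots,v_{i+n-p}),v_{i+n-p+1},\dots,v_n).$$ It is *unital* if $\Psi_{(z)}=\mathrm{id}_V$ for all $z\in F(1,\mathbb{C})=\mathbb{C}$. **$\underline{\mathcal M}$-algebra.** An *$\underline{\mathcal M}$-algebra* structure on $V$ is a family of continuous maps $A_n:\underline{\mathcal M}(n)\to\operatorname{Hom}(V^{\otimes n},V)$, $n\ge1$, smooth on the open strata $\mathcal M(n)$ (i.e. with smooth pullback to $F(n,\mathbb{C})$), that is $S_n$-equivariant, satisfies $A(x\circ_i y)=A(x)\circ_i A(y)$ for all $x,y,i$,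 and takes the unit to $\mathrm{id}_V$. Without the last condition it is called *nonunital*. **Proposition.** $V$ is a unital reduced conformal field theory if and only if $V$ is an $\underline{\mathcal M}$-algebra. More precisely, restriction along $F(n,\mathbb{C})\to\underline{\mathcal M}(n)$ is a bijection from the set of $\underline{\mathcal M}$-algebra structures on $V$ onto the set of unital reduced conformal field theory structures on $V$. Likewise it is a bijection from the set of nonunital $\underline{\mathcal M}$-algebra structures on $V$ onto the set of all reduced conformal field theory structures on $V$. -/

import Mathlib

open Set Filter Topology

noncomputable section

namespace ConfOperad

/-! Everything of index `n` has arity `n + 1` (so all arities `≥ 1` occur, and no others).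
The partial composition `∘ᵢ` of arities `m + 1` and `n + 1` has arity `m + n + 1`. -/

section Index

variable {m n : ℕ}

/-- The `k`-th input of a composite `x ∘ᵢ y` is an input of `y`. -/
def IsInner (i : Fin (m + 1)) (k : Fin (m + n + 1)) : Prop :=
  (i : ℕ) ≤ k ∧ (k : ℕ) ≤ i + n

instance (i : Fin (m + 1)) (k : Fin (m + n + 1)) : Decidable (IsInner i k) := by
  unfold IsInner; infer_instance

/-- The input of `x` to which the `k`-th input of `x ∘ᵢ y` belongs (it is `i` for all inputs
of `y`). -/
def outer (i : Fin (m + 1)) (k : Fin (m + n + 1)) : Fin (m + 1) :=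
  if (k : ℕ) < i then ⟨min k m, by omega⟩
  else if (k : ℕ) ≤ i + n then i else ⟨k - n, by omega⟩

/-- The input of `y` that is the `k`-th input of `x ∘ᵢ y`; meaningful if `IsInner i k`. -/
def inner (i : Fin (m + 1)) (k : Fin (m + n + 1)) : Fin (n + 1) :=
  ⟨min (k - i) n, by omega⟩

/-- The position in `x ∘ᵢ y` of the `b`-th input of `y`. -/
def innerPos (i : Fin (m + 1)) (b : Fin (n + 1)) : Fin (m + n + 1) :=
  ⟨i + b, by omega⟩

/-- The position in `x ∘ᵢ y` of the `a`-th input of `x`, for `a ≠ i`. -/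
def outerPos (i a : Fin (m + 1)) : Fin (m + n + 1) :=
  if (a : ℕ) < i then ⟨a, by omega⟩ else ⟨a + n, by omega⟩

theorem outer_eq_of_isInner {i : Fin (m + 1)} {k : Fin (m + n + 1)} (h : IsInner i k) :
    outer i k = i := by
  unfold outer
  rw [if_neg (by have := h.1; omega), if_pos h.2]

theorem eq_of_inner_eq {i : Fin (m + 1)} {k l : Fin (m + n + 1)} (hk : IsInner i k)
    (hl : IsInner i l) (h : inner i k = inner i l) : k = l := by
  unfold inner at h
  unfold IsInner at hk hl
  simp only [Fin.mk.injEq] at h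
  ext; omega

theorem eq_of_outer_eq {i : Fin (m + 1)} {k l : Fin (m + n + 1)}
    (h : outer i k = outer i l) (hkl : ¬ (IsInner i k ∧ IsInner i l)) : k = l := by
  unfold outer at h
  unfold IsInner at hkl
  ext
  split_ifs at h <;> simp only [Fin.ext_iff] at h <;> omega

theorem pos_cases (i : Fin (m + 1)) (k : Fin (m + n + 1)) :
    (∃ b, k = innerPos i b) ∨ ∃ a, a ≠ i ∧ k = outerPos i a := by
  by_cases h1 : (k : ℕ) < i
  · refine Or.inr ⟨⟨k, by omega⟩, ?_, ?_⟩
    · intro h; simp only [Fin.ext_iff] at h; omega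
    · unfold outerPos; simp [h1]
  by_cases h2 : (k : ℕ) ≤ i + n
  · refine Or.inl ⟨⟨k - i, by omega⟩, ?_⟩
    unfold innerPos; ext; simp; omega
  · refine Or.inr ⟨⟨k - n, by omega⟩, ?_, ?_⟩
    · intro h; simp only [Fin.ext_iff] at h; omega
    · unfold outerPos
      rw [if_neg (by simp; omega)]
      ext; simp; omega

theorem innerPos_inj {i : Fin (m + 1)} {b c : Fin (n + 1)}
    (h : innerPos i b = innerPos i c) : b = c := by
  unfold innerPos at h
  simp only [Fin.mk.injEq] at h
  ext; omega

theorem outerPos_inj {i a c : Fin (m + 1)}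
    (h : (outerPos i a : Fin (m + n + 1)) = outerPos i c) : a = c := by
  unfold outerPos at h
  ext
  split_ifs at h <;> simp only [Fin.mk.injEq] at h <;> omega

theorem innerPos_ne_outerPos {i a : Fin (m + 1)} (ha : a ≠ i) (b : Fin (n + 1)) :
    innerPos i b ≠ outerPos i a := by
  intro h
  unfold innerPos outerPos at h
  have ha' : (a : ℕ) ≠ i := fun h => ha (Fin.ext h)
  split_ifs at h <;> simp only [Fin.mk.injEq] at h <;> omega

end Index

/-! ### Configurations and their compactification -/

/-- The configuration space of `n + 1` distinct ordered points of the complex plane. -/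
def Conf (n : ℕ) : Set (Fin (n + 1) → ℂ) := {z | Function.Injective z}

/-- Relabelling of a configuration: `(z_{σ 0}, …, z_{σ n})`. -/
def Conf.relabel {n : ℕ} (σ : Equiv.Perm (Fin (n + 1))) (z : Conf n) : Conf n :=
  ⟨fun j => z.1 (σ j), z.2.comp σ.injective⟩

/-- The affine image `(a z₀ + b, …, a zₙ + b)` of a configuration, for `a > 0`. -/
def Conf.affine {n : ℕ} (a : ℝ) (ha : 0 < a) (b : ℂ) (z : Conf n) : Conf n :=
  ⟨fun j => (a : ℂ) * z.1 j + b, fun j k h => z.2 (by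
    have ha' : (a : ℂ) ≠ 0 := by exact_mod_cast ha.ne'
    exact mul_left_cancel₀ ha' (add_right_cancel h))⟩

/-- Direction coordinates (one for each ordered pair of labels) and relative distance
coordinates in `[0, ∞]` (one for each ordered triple). -/
abbrev Coord (n : ℕ) : Type :=
  (Fin (n + 1) → Fin (n + 1) → ℂ) × (Fin (n + 1) → Fin (n + 1) → Fin (n + 1) → ENNReal)

/-- The coordinates of a configuration: the unit vectors `(z_j - z_k) / |z_j - z_k|` and the
ratios `|z_j - z_k| / |z_j - z_l|`. The coordinates with coinciding labels are constant on
configurations: the direction is `0` for `j = k`; the ratio is `0` for `j = k`, it is `∞` for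
`j = l ≠ k` and it is `1` for `k = l ≠ j`. -/
def coord {n : ℕ} (z : Fin (n + 1) → ℂ) : Coord n :=
  (fun j k => (z j - z k) / (‖z j - z k‖ : ℂ),
   fun j k l => ENNReal.ofReal ‖z j - z k‖ / ENNReal.ofReal ‖z j - z l‖)

/-- The compactified configuration space of `n + 1` points, modulo translations and positive
dilations (the real Fulton–MacPherson, or Axelrod–Singer, compactification): the closure of
the image of the configuration space in the product of circles and intervals `[0, ∞]`. -/
def MbarSet (n : ℕ) : Set (Coord n) := closure (coord '' Conf n)

/-- The compactified configuration space, with the subspace topology. -/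
abbrev Mbar (n : ℕ) : Type := MbarSet n

/-- The point of the compactification that is given by a configuration; the image of this
map is the open stratum, the quotient of `Conf n` by translations and positive dilations. -/
def Mbar.of {n : ℕ} (z : Conf n) : Mbar n :=
  ⟨coord z.1, subset_closure ⟨z.1, z.2, rfl⟩⟩

/-- The action of permutations on coordinates. -/
def Coord.relabel {n : ℕ} (σ : Equiv.Perm (Fin (n + 1))) (x : Coord n) : Coord n :=
  (fun j k => x.1 (σ j) (σ k), fun j k l => x.2 (σ j) (σ k) (σ l))

theorem Coord.continuous_relabel {n : ℕ} (σ : Equiv.Perm (Fin (n + 1))) :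
    Continuous (Coord.relabel σ) := by
  unfold Coord.relabel; fun_prop

/-- The action of permutations on the compactification. -/
def Mbar.relabel {n : ℕ} (σ : Equiv.Perm (Fin (n + 1))) (x : Mbar n) : Mbar n :=
  ⟨Coord.relabel σ x.1, by
    refine map_mem_closure (Coord.continuous_relabel σ) x.2 ?_
    rintro _ ⟨z, hz, rfl⟩
    exact ⟨fun j => z (σ j), hz.comp σ.injective, rfl⟩⟩

/-- The operad composition in coordinates: the configuration `y` is inserted, infinitesimally
small, at the `i`-th point of `x`. Directions and ratios among points of `y` are those of `y`;
all others are those of `x`, with every point of `y` in the position of the `i`-th point. (So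
the ratio of a distance within `y` to one not within `y` is `x.2 i i l = 0`, etc.) -/
def Coord.comp {m n : ℕ} (i : Fin (m + 1)) (x : Coord m) (y : Coord n) : Coord (m + n) :=
  (fun j k =>
    if IsInner i j ∧ IsInner i k then y.1 (inner i j) (inner i k)
    else x.1 (outer i j) (outer i k),
   fun j k l =>
    if IsInner i j ∧ IsInner i k ∧ IsInner i l then y.2 (inner i j) (inner i k) (inner i l)
    else x.2 (outer i j) (outer i k) (outer i l))

theorem Coord.continuous_comp {m n : ℕ} (i : Fin (m + 1)) :
    Continuous (fun p : Coord m × Coord n => Coord.comp i p.1 p.2) := by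
  unfold Coord.comp
  refine Continuous.prodMk ?_ ?_
  · refine continuous_pi fun j => continuous_pi fun k => ?_
    split_ifs <;> fun_prop
  · refine continuous_pi fun j => continuous_pi fun k => continuous_pi fun l => ?_
    split_ifs <;> fun_prop

/-- Insertion of the configuration `w`, shrunk by the factor `ε`, at the point `z i`. -/
def insertAt {m n : ℕ} (i : Fin (m + 1)) (z : Fin (m + 1) → ℂ) (w : Fin (n + 1) → ℂ) (ε : ℝ) :
    Fin (m + n + 1) → ℂ :=
  fun k => z (outer i k) + if IsInner i k then (ε : ℂ) * w (inner i k) else 0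

theorem insertAt_sub_of_isInner {m n : ℕ} {i : Fin (m + 1)} (z : Fin (m + 1) → ℂ)
    (w : Fin (n + 1) → ℂ) (ε : ℝ) {j k : Fin (m + n + 1)} (hj : IsInner i j)
    (hk : IsInner i k) :
    insertAt i z w ε j - insertAt i z w ε k = (ε : ℂ) * (w (inner i j) - w (inner i k)) := by
  unfold insertAt
  rw [if_pos hj, if_pos hk, outer_eq_of_isInner hj, outer_eq_of_isInner hk]
  ring

theorem tendsto_insertAt_sub {m n : ℕ} (i : Fin (m + 1)) (z : Fin (m + 1) → ℂ)
    (w : Fin (n + 1) → ℂ) (j k : Fin (m + n + 1)) :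
    Tendsto (fun ε : ℝ => insertAt i z w ε j - insertAt i z w ε k) (𝓝[>] 0)
      (𝓝 (z (outer i j) - z (outer i k))) := by
  have h : ∀ k, Tendsto (fun ε : ℝ => insertAt i z w ε k) (𝓝[>] 0) (𝓝 (z (outer i k))) := by
    intro k
    have hc : Continuous (fun ε : ℝ => insertAt i z w ε k) := by
      unfold insertAt
      split_ifs <;> fun_prop
    have h0 : insertAt i z w 0 k = z (outer i k) := by simp [insertAt]
    have := hc.tendsto 0
    rw [h0] at this
    exact this.mono_left nhdsWithin_le_nhds
  exact (h j).sub (h k)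

theorem eventually_insertAt_mem {m n : ℕ} (i : Fin (m + 1)) {z : Fin (m + 1) → ℂ}
    {w : Fin (n + 1) → ℂ} (hz : z ∈ Conf m) (hw : w ∈ Conf n) :
    ∀ᶠ ε : ℝ in 𝓝[>] 0, insertAt i z w ε ∈ Conf (m + n) := by
  have h : ∀ j k : Fin (m + n + 1), j ≠ k →
      ∀ᶠ ε : ℝ in 𝓝[>] 0, insertAt i z w ε j - insertAt i z w ε k ≠ 0 := by
    intro j k hjk
    by_cases hin : IsInner i j ∧ IsInner i k
    · filter_upwards [self_mem_nhdsWithin] with ε hε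
      rw [insertAt_sub_of_isInner z w ε hin.1 hin.2]
      refine mul_ne_zero (by exact_mod_cast (ne_of_gt hε)) (sub_ne_zero.2 fun h => hjk ?_)
      exact eq_of_inner_eq hin.1 hin.2 (hw h)
    · refine (tendsto_insertAt_sub i z w j k).eventually_ne (sub_ne_zero.2 fun h => hjk ?_)
      exact eq_of_outer_eq (hz h) hin
  have h' : ∀ᶠ ε : ℝ in 𝓝[>] 0, ∀ j k : Fin (m + n + 1), j ≠ k →
      insertAt i z w ε j - insertAt i z w ε k ≠ 0 := by
    simp only [eventually_all]
    exact h
  filter_upwards [h'] with ε hε j k hjk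
  by_contra hne
  exact hε j k hne (sub_eq_zero.2 hjk)

theorem tendsto_coord_insertAt {m n : ℕ} (i : Fin (m + 1)) {z : Fin (m + 1) → ℂ}
    {w : Fin (n + 1) → ℂ} (hz : z ∈ Conf m) :
    Tendsto (fun ε : ℝ => coord (insertAt i z w ε)) (𝓝[>] 0)
      (𝓝 (Coord.comp i (coord z) (coord w))) := by
  refine Tendsto.prodMk_nhds ?_ ?_
  · refine tendsto_pi_nhds.2 fun j => tendsto_pi_nhds.2 fun k => ?_
    by_cases hin : IsInner i j ∧ IsInner i k
    · simp only [if_pos hin]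
      refine tendsto_const_nhds.congr' ?_
      filter_upwards [self_mem_nhdsWithin] with ε hε
      have hε' : (0 : ℝ) < ε := hε
      have hεc : (ε : ℂ) ≠ 0 := by exact_mod_cast hε'.ne'
      simp only [coord, insertAt_sub_of_isInner z w ε hin.1 hin.2, norm_mul,
        Complex.norm_real, Real.norm_of_nonneg hε'.le, Complex.ofReal_mul]
      exact (mul_div_mul_left _ _ hεc).symm
    · simp only [if_neg hin]
      by_cases hjk : j = k
      · subst hjk
        simp [coord]
      · have ht := tendsto_insertAt_sub i z w j k
        have hne : z (outer i j) - z (outer i k) ≠ 0 :=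
          sub_ne_zero.2 fun h => hjk (eq_of_outer_eq (hz h) hin)
        refine ht.div ((Complex.continuous_ofReal.tendsto _).comp ht.norm) ?_
        exact_mod_cast (norm_ne_zero_iff.2 hne)
  · refine tendsto_pi_nhds.2 fun j => tendsto_pi_nhds.2 fun k => tendsto_pi_nhds.2 fun l => ?_
    by_cases hin : IsInner i j ∧ IsInner i k ∧ IsInner i l
    · simp only [if_pos hin]
      refine tendsto_const_nhds.congr' ?_
      filter_upwards [self_mem_nhdsWithin] with ε hε
      have hε' : (0 : ℝ) < ε := hε
      simp only [coord, insertAt_sub_of_isInner z w ε hin.1 hin.2.1,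
        insertAt_sub_of_isInner z w ε hin.1 hin.2.2, norm_mul,
        Complex.norm_real, Real.norm_of_nonneg hε'.le, ENNReal.ofReal_mul hε'.le]
      exact (ENNReal.mul_div_mul_left _ _ (by simpa using hε') ENNReal.ofReal_ne_top).symm
    · simp only [if_neg hin]
      by_cases hjk : j = k ∧ j = l
      · obtain ⟨rfl, rfl⟩ := hjk
        simp [coord]
      · have ht := tendsto_insertAt_sub i z w j k
        have ht' := tendsto_insertAt_sub i z w j l
        have hne : z (outer i j) - z (outer i k) ≠ 0 ∨ z (outer i j) - z (outer i l) ≠ 0 := by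
          by_contra! hcon
          have h1 := hz (sub_eq_zero.1 hcon.1)
          have h2 := hz (sub_eq_zero.1 hcon.2)
          by_cases hj : IsInner i j
          · by_cases hk : IsInner i k
            · have hl : ¬ IsInner i l := fun hl => hin ⟨hj, hk, hl⟩
              have := eq_of_outer_eq h2 (fun h => hl h.2)
              exact hl (this ▸ hj)
            · have := eq_of_outer_eq h1 (fun h => hk h.2)
              exact hk (this ▸ hj)
          · exact hjk ⟨eq_of_outer_eq h1 (fun h => hj h.1),
              eq_of_outer_eq h2 (fun h => hj h.1)⟩
        refine ENNReal.Tendsto.div (ENNReal.tendsto_ofReal ht.norm) ?_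
          (ENNReal.tendsto_ofReal ht'.norm) (Or.inl ENNReal.ofReal_ne_top)
        simpa [sub_ne_zero] using hne.imp (norm_pos_iff.2) (norm_pos_iff.2)

/-- The partial composition `∘ᵢ` of the compactified configuration operad. -/
def Mbar.comp {m n : ℕ} (i : Fin (m + 1)) (x : Mbar m) (y : Mbar n) : Mbar (m + n) :=
  ⟨Coord.comp i x.1 y.1, by
    have hxy : ((x.1, y.1) : Coord m × Coord n) ∈
        closure ((coord '' Conf m) ×ˢ (coord '' Conf n)) := by
      rw [closure_prod_eq]; exact ⟨x.2, y.2⟩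
    have h := map_mem_closure (t := closure (coord '' Conf (m + n)))
      (Coord.continuous_comp (m := m) (n := n) i) hxy ?_
    · rwa [closure_closure] at h
    · rintro ⟨_, _⟩ ⟨⟨z, hz, rfl⟩, ⟨w, hw, rfl⟩⟩
      refine mem_closure_of_tendsto (tendsto_coord_insertAt i hz) ?_
      filter_upwards [eventually_insertAt_mem i hz hw] with ε hε
      exact ⟨_, hε, rfl⟩⟩

/-- The operad unit, the only point of the arity one component. -/
def Mbar.unit : Mbar 0 := Mbar.of ⟨fun _ => 0, fun j k _ => by ext; omega⟩

/-! ### The endomorphism operad of a topological vector space -/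

/-- The arguments of `f` in `f ∘ᵢ g`: the value of `g` in the `i`-th place, the remaining
vectors in the other places. -/
def compArgs {V : Type*} {m n : ℕ} (i : Fin (m + 1)) (g : (Fin (n + 1) → V) → V) (v : Fin (m + n + 1) → V) :
    Fin (m + 1) → V :=
  fun a => if a = i then g (fun b => v (innerPos i b)) else v (outerPos i a)

theorem compArgs_update_inner {V : Type*} {m n : ℕ} [DecidableEq (Fin (m + n + 1))] (i : Fin (m + 1))
    (g : (Fin (n + 1) → V) → V) (v : Fin (m + n + 1) → V) (b : Fin (n + 1)) (x : V) :
    compArgs i g (Function.update v (innerPos i b) x) =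
      Function.update (compArgs i g v) i
        (g (Function.update (fun c => v (innerPos i c)) b x)) := by
  funext a
  by_cases ha : a = i
  · subst ha
    simp only [compArgs, if_true, Function.update_self]
    congr 1
    funext c
    by_cases hc : c = b
    · subst hc; simp
    · rw [Function.update_of_ne hc, Function.update_of_ne fun h => hc (innerPos_inj h)]
  · rw [Function.update_of_ne ha]
    simp only [compArgs, if_neg ha]
    rw [Function.update_of_ne (innerPos_ne_outerPos ha b).symm]

theorem compArgs_update_outer {V : Type*} {m n : ℕ} [DecidableEq (Fin (m + n + 1))] (i : Fin (m + 1))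
    (g : (Fin (n + 1) → V) → V) (v : Fin (m + n + 1) → V) {a : Fin (m + 1)} (ha : a ≠ i) (x : V) :
    compArgs i g (Function.update v (outerPos i a) x) =
      Function.update (compArgs i g v) a x := by
  funext c
  by_cases hc : c = i
  · subst hc
    rw [Function.update_of_ne ha.symm]
    simp only [compArgs, if_true]
    congr 1
    funext b
    rw [Function.update_of_ne (innerPos_ne_outerPos ha b)]
  · by_cases hca : c = a
    · subst hca; simp [compArgs, hc]
    · rw [Function.update_of_ne hca]
      simp only [compArgs, if_neg hc]
      rw [Function.update_of_ne fun h => hca (outerPos_inj h)]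

section Hom

variable (𝕜 : Type*) [RCLike 𝕜] (V : Type*) [AddCommGroup V] [Module 𝕜 V] [TopologicalSpace V]

/-- `Hom(V^{⊗(n+1)}, V)`: the continuous `(n+1)`-linear maps. -/
def MultiHom (n : ℕ) : Type _ := ContinuousMultilinearMap 𝕜 (fun _ : Fin (n + 1) => V) V

instance (n : ℕ) : FunLike (MultiHom 𝕜 V n) (Fin (n + 1) → V) V :=
  inferInstanceAs (FunLike (ContinuousMultilinearMap 𝕜 (fun _ : Fin (n + 1) => V) V) _ _)

/-- The topology of pointwise convergence. -/
instance (n : ℕ) : TopologicalSpace (MultiHom 𝕜 V n) :=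
  TopologicalSpace.induced (fun f (v : Fin (n + 1) → V) => f v) inferInstance

instance (n : ℕ) [IsTopologicalAddGroup V] : AddCommGroup (MultiHom 𝕜 V n) :=
  inferInstanceAs (AddCommGroup (ContinuousMultilinearMap 𝕜 (fun _ : Fin (n + 1) => V) V))

instance (n : ℕ) [IsTopologicalAddGroup V] [ContinuousSMul 𝕜 V] : Module 𝕜 (MultiHom 𝕜 V n) :=
  inferInstanceAs (Module 𝕜 (ContinuousMultilinearMap 𝕜 (fun _ : Fin (n + 1) => V) V))

variable {𝕜 V}

/-- `(f ∘ᵢ g)(v) = f (v₀, …, v_{i-1}, g (v_i, …, v_{i+n}), v_{i+n+1}, …, v_{m+n})`. -/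
def MultiHom.comp {m n : ℕ} (i : Fin (m + 1)) (f : MultiHom 𝕜 V m) (g : MultiHom 𝕜 V n) :
    MultiHom 𝕜 V (m + n) :=
  let f' : ContinuousMultilinearMap 𝕜 (fun _ : Fin (m + 1) => V) V := f
  let g' : ContinuousMultilinearMap 𝕜 (fun _ : Fin (n + 1) => V) V := g
  show ContinuousMultilinearMap 𝕜 (fun _ : Fin (m + n + 1) => V) V from
  { toFun := fun v => f' (compArgs i g' v)
    map_update_add' := by
      intro _ v k x y
      rcases pos_cases i k with ⟨b, rfl⟩ | ⟨a, ha, rfl⟩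
      · simp only [compArgs_update_inner, ContinuousMultilinearMap.map_update_add]
      · simp only [compArgs_update_outer i g' v ha, ContinuousMultilinearMap.map_update_add]
    map_update_smul' := by
      intro _ v k c x
      rcases pos_cases i k with ⟨b, rfl⟩ | ⟨a, ha, rfl⟩
      · simp only [compArgs_update_inner, ContinuousMultilinearMap.map_update_smul]
      · simp only [compArgs_update_outer i g' v ha, ContinuousMultilinearMap.map_update_smul]
    cont := by
      refine f'.cont.comp (continuous_pi fun a => ?_)
      unfold compArgs
      split_ifs
      · exact g'.cont.comp (by fun_prop)
      · fun_prop }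

end Hom

/-! ### Smoothness -/

/-- A map from the configuration space (an open subset of `ℂ^{n+1}`) to a topological vector
space is smooth (as a function of real variables) if its iterated directional derivatives
`D j z (h₁, …, h_j)` of all orders exist and are jointly continuous in the point and the
directions. -/
def SmoothOnConf (𝕜 : Type*) [RCLike 𝕜] {W : Type*} [AddCommGroup W] [Module 𝕜 W]
    [TopologicalSpace W] {n : ℕ} (f : Conf n → W) : Prop :=
  ∃ D : (j : ℕ) → Conf n → (Fin j → Fin (n + 1) → ℂ) → W,
    (∀ z h, D 0 z h = f z) ∧
    (∀ j, Continuous fun p : Conf n × (Fin j → Fin (n + 1) → ℂ) => D j p.1 p.2) ∧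
    ∀ (j : ℕ) (z : Conf n) (h : Fin j → Fin (n + 1) → ℂ) (u : Fin (n + 1) → ℂ),
      Tendsto
        (fun t : ℝ => ((t⁻¹ : ℝ) : 𝕜) •
          (Function.extend Subtype.val (fun y : Conf n => D j y h) 0 (z.1 + t • u) - D j z h))
        (𝓝[≠] 0) (𝓝 (D (j + 1) z (Fin.cons u h)))

/-! ### Reduced conformal field theories and algebras over the operad -/

/-- Formal iterated `∘ᵢ`-compositions of configurations. -/
inductive ConfTree : ℕ → Type
  | conf {n : ℕ} (z : Conf n) : ConfTree n
  | comp {m n : ℕ} (i : Fin (m + 1)) (s : ConfTree m) (t : ConfTree n) : ConfTree (m + n)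

/-- The value of an iterated composition in the compactified configuration operad. -/
def ConfTree.toMbar : {n : ℕ} → ConfTree n → Mbar n
  | _, .conf z => Mbar.of z
  | _, .comp i s t => Mbar.comp i s.toMbar t.toMbar

section Theories

variable {𝕜 : Type*} [RCLike 𝕜] {V : Type*} [AddCommGroup V] [Module 𝕜 V] [TopologicalSpace V]

/-- The corresponding iterated composition of the operators `Ψ_z`. -/
def ConfTree.eval (Ψ : (n : ℕ) → Conf n → MultiHom 𝕜 V n) : {n : ℕ} → ConfTree n → MultiHom 𝕜 V n
  | _, .conf z => Ψ _ z
  | _, .comp i s t => MultiHom.comp i (s.eval Ψ) (t.eval Ψ)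

/-- The restriction of a family of maps on the compactifications to configurations. -/
def restrict (A : (n : ℕ) → Mbar n → MultiHom 𝕜 V n) : (n : ℕ) → Conf n → MultiHom 𝕜 V n :=
  fun n z => A n (Mbar.of z)

variable [IsTopologicalAddGroup V] [ContinuousSMul 𝕜 V]

/-- The family `Ψ` makes `V` a reduced conformal field theory. -/
structure IsReducedCFT (Ψ : (n : ℕ) → Conf n → MultiHom 𝕜 V n) : Prop where
  smooth : ∀ n, SmoothOnConf 𝕜 (Ψ n)
  equivariant : ∀ (n : ℕ) (σ : Equiv.Perm (Fin (n + 1))) (z : Conf n) (v : Fin (n + 1) → V),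
    Ψ n (Conf.relabel σ z) (fun j => v (σ j)) = Ψ n z v
  invariant : ∀ (n : ℕ) (a : ℝ) (ha : 0 < a) (b : ℂ) (z : Conf n),
    Ψ n (Conf.affine a ha b z) = Ψ n z
  /-- As a configuration approaches, in the compactification, an iterated composition of
  configurations, the operators converge to the composition of operators. -/
  limit : ∀ (n : ℕ) (T : ConfTree n) (v : Fin (n + 1) → V),
    Tendsto (fun z : Conf n => Ψ n z v) (comap Mbar.of (𝓝 T.toMbar)) (𝓝 (T.eval Ψ v))

/-- The family `A` of continuous maps, smooth on the open strata, is compatible with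
permutations and with the partial compositions of the compactified configuration operad. -/
structure IsNonunitalMbarAlgebra (A : (n : ℕ) → Mbar n → MultiHom 𝕜 V n) : Prop where
  continuous : ∀ n, Continuous (A n)
  /-- Smoothness on the open stratum, the quotient manifold of `Conf n` by translations and
  positive dilations, is smoothness of the pullback to `Conf n`. -/
  smooth : ∀ n, SmoothOnConf 𝕜 (fun z : Conf n => A n (Mbar.of z))
  equivariant : ∀ (n : ℕ) (σ : Equiv.Perm (Fin (n + 1))) (x : Mbar n) (v : Fin (n + 1) → V),
    A n (Mbar.relabel σ x) (fun j => v (σ j)) = A n x v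
  map_comp : ∀ (m n : ℕ) (i : Fin (m + 1)) (x : Mbar m) (y : Mbar n),
    A (m + n) (Mbar.comp i x y) = MultiHom.comp i (A m x) (A n y)

/-- The family `A` makes `V` an algebra over the compactified configuration operad. -/
structure IsMbarAlgebra (A : (n : ℕ) → Mbar n → MultiHom 𝕜 V n) : Prop
    extends IsNonunitalMbarAlgebra A where
  map_unit : ∀ v : Fin 1 → V, A 0 Mbar.unit v = v 0

end Theories

end ConfOperad

end

open Set Filter Topology

noncomputable section

namespace ConfOperad

/-! ### Coordinates of configurations indexed by a finite type -/

section Labels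

/-! The heart of the matter is the stratification of the compactification: every point is, up to
relabelling, an iterated composition of configurations (`exists_confTree`). To see this, write a
point as a limit of configurations, normalise these by translation and dilation, and take a cluster
point `p` in the compact set of normalised families. This `p` is not constant, and it determines
every coordinate except those among labels with a common value of `p` (`exists_macroscopic`). If `p`
is injective, the point is `p` itself. Otherwise a fibre `B` with at least two labels is a proper
subset, the point is the composition of its restriction to `B` into its restriction to the quotient
by `B`, and both have fewer labels.

Given a reduced CFT, the limit axiom together with equivariance then provides limits of `Ψ` at all
points of the compactification. Since `V` is regular, the limits form a continuous extension
(`continuous_of_tendsto_comap`). The algebra identities hold on configurations and persist by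
density. Conversely, the limit axiom for an algebra is continuity at a composite point, where the
value is the composition of operators. Injectivity of restriction is density and the Hausdorff
property. -/

/-- Direction and ratio coordinates of a family of points with labels in `ι`. -/
def labelCoord {ι : Type} (z : ι → ℂ) : (ι → ι → ℂ) × (ι → ι → ι → ENNReal) :=
  (fun j k => (z j - z k) / (‖z j - z k‖ : ℂ),
   fun j k l => ENNReal.ofReal ‖z j - z k‖ / ENNReal.ofReal ‖z j - z l‖)

/-- Pullback of coordinates along a map of labels. -/
def pullCoord {ι κ : Type} (e : ι → κ) (x : (κ → κ → ℂ) × (κ → κ → κ → ENNReal)) :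
    (ι → ι → ℂ) × (ι → ι → ι → ENNReal) :=
  (fun j k => x.1 (e j) (e k), fun j k l => x.2 (e j) (e k) (e l))

theorem continuous_pullCoord {ι κ : Type} (e : ι → κ) : Continuous (pullCoord e) := by
  unfold pullCoord; fun_prop

/-- For `e` the inclusion of a set of labels this is the map that forgets the other points. The
induction uses it to pass to a fibre and to a quotient. -/
theorem pullCoord_mem_closure {ι κ : Type} {e : ι → κ} (he : Function.Injective e)
    {x : (κ → κ → ℂ) × (κ → κ → κ → ENNReal)}
    (hx : x ∈ closure (labelCoord '' {z : κ → ℂ | Function.Injective z})) :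
    pullCoord e x ∈ closure (labelCoord '' {z : ι → ℂ | Function.Injective z}) := by
  refine map_mem_closure (continuous_pullCoord e) hx ?_
  rintro _ ⟨z, hz, rfl⟩
  exact ⟨fun j => z (e j), hz.comp he, rfl⟩

theorem labelCoord_affine {ι : Type} {a : ℝ} (ha : 0 < a) (b : ℂ) (z : ι → ℂ) :
    labelCoord (fun j => (a : ℂ) * z j + b) = labelCoord z := by
  have hac : (a : ℂ) ≠ 0 := by exact_mod_cast ha.ne'
  have h : ∀ j k, ((a : ℂ) * z j + b) - ((a : ℂ) * z k + b) = (a : ℂ) * (z j - z k) :=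
    fun j k => by ring
  unfold labelCoord
  simp only [h, norm_mul, Complex.norm_real, Real.norm_of_nonneg ha.le, Complex.ofReal_mul,
    ENNReal.ofReal_mul ha.le]
  refine Prod.ext ?_ ?_
  · funext j k
    exact mul_div_mul_left _ _ hac
  · funext j k l
    exact ENNReal.mul_div_mul_left _ _ (by simpa using ha) ENNReal.ofReal_ne_top

/-! ### Limits of coordinates and the macroscopic configuration -/

theorem tendsto_labelCoord_fst {ι : Type} {p : ι → ℂ} {j k : ι} (h : p j ≠ p k) :
    Tendsto (fun z : ι → ℂ => (labelCoord z).1 j k) (𝓝 p) (𝓝 ((labelCoord p).1 j k)) := by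
  have ht : Tendsto (fun z : ι → ℂ => z j - z k) (𝓝 p) (𝓝 (p j - p k)) :=
    Continuous.tendsto (by fun_prop) p
  refine ht.div ((Complex.continuous_ofReal.tendsto _).comp ht.norm) ?_
  exact_mod_cast norm_ne_zero_iff.2 (sub_ne_zero.2 h)

/-- Division in `[0, ∞]` is continuous away from `0/0` and `∞/∞`. The hypothesis excludes the
former, finiteness of distances the latter. -/
theorem tendsto_labelCoord_snd {ι : Type} {p : ι → ℂ} {j k l : ι} (h : p j ≠ p k ∨ p j ≠ p l) :
    Tendsto (fun z : ι → ℂ => (labelCoord z).2 j k l) (𝓝 p) (𝓝 ((labelCoord p).2 j k l)) := by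
  have ht : ∀ k, Tendsto (fun z : ι → ℂ => z j - z k) (𝓝 p) (𝓝 (p j - p k)) :=
    fun k => Continuous.tendsto (by fun_prop) p
  refine ENNReal.Tendsto.div (ENNReal.tendsto_ofReal (ht k).norm) ?_
    (ENNReal.tendsto_ofReal (ht l).norm) (Or.inl ENNReal.ofReal_ne_top)
  simpa [sub_ne_zero] using h

/-- The families of points in the closed unit disc, one of which is `0` and another one of
which has absolute value `1`. -/
def normalized (ι : Type) : Set (ι → ℂ) :=
  (⋃ a : ι, ⋃ b : ι, {z | z a = 0 ∧ ‖z b‖ = 1}) ∩ Set.pi univ fun _ => Metric.closedBall 0 1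

theorem isCompact_normalized (ι : Type) [Finite ι] : IsCompact (normalized ι) := by
  refine IsCompact.inter_left (isCompact_univ_pi fun _ => isCompact_closedBall 0 1) ?_
  refine isClosed_iUnion_of_finite fun a => isClosed_iUnion_of_finite fun b => ?_
  exact (isClosed_eq (by fun_prop) continuous_const).inter
    (isClosed_eq (by fun_prop) continuous_const)

theorem exists_normalized {ι : Type} [Finite ι] [Nontrivial ι] {z : ι → ℂ}
    (hz : Function.Injective z) :
    ∃ w ∈ normalized ι, labelCoord w = labelCoord z := by
  -- Choose a pair at maximal distance `r`; the normalised family is `(z - z a) / r`.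
  obtain ⟨⟨a, b⟩, hab⟩ := Finite.exists_max (fun q : ι × ι => ‖z q.2 - z q.1‖)
  obtain ⟨c, d, hcd⟩ := exists_pair_ne ι
  have hr : 0 < ‖z b - z a‖ :=
    (norm_pos_iff.2 (sub_ne_zero.2 fun h => hcd (hz h.symm))).trans_le (hab (c, d))
  set r := ‖z b - z a‖ with hrdef
  have hr' : 0 < r⁻¹ := inv_pos.2 hr
  have hw : ∀ j, ((r⁻¹ : ℝ) : ℂ) * z j + -((r⁻¹ : ℝ) : ℂ) * z a =
      ((r⁻¹ : ℝ) : ℂ) * (z j - z a) := fun j => by ring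
  have hn : ∀ j, ‖((r⁻¹ : ℝ) : ℂ) * (z j - z a)‖ = r⁻¹ * ‖z j - z a‖ := fun j => by
    rw [norm_mul, Complex.norm_real, Real.norm_of_nonneg hr'.le]
  refine ⟨fun j => ((r⁻¹ : ℝ) : ℂ) * z j + -((r⁻¹ : ℝ) : ℂ) * z a, ⟨?_, ?_⟩,
    labelCoord_affine hr' _ z⟩
  · refine mem_iUnion.2 ⟨a, mem_iUnion.2 ⟨b, ?_, ?_⟩⟩
    · exact (hw a).trans (by rw [sub_self, mul_zero])
    · change ‖((r⁻¹ : ℝ) : ℂ) * z b + -((r⁻¹ : ℝ) : ℂ) * z a‖ = 1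
      rw [hw, hn, ← hrdef, inv_mul_cancel₀ hr.ne']
  · intro j _
    rw [mem_closedBall_zero_iff]
    change ‖((r⁻¹ : ℝ) : ℂ) * z j + -((r⁻¹ : ℝ) : ℂ) * z a‖ ≤ 1
    rw [hw, hn, inv_mul_le_one₀ hr]
    exact hab (a, j)

/-- A point of the compactification has a nonconstant macroscopic configuration `p`, which
determines all the coordinates that are not internal to a fibre of `p`. -/
theorem exists_macroscopic {ι : Type} [Finite ι] [Nontrivial ι]
    {x : (ι → ι → ℂ) × (ι → ι → ι → ENNReal)}
    (hx : x ∈ closure (labelCoord '' {z : ι → ℂ | Function.Injective z})) :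
    ∃ p : ι → ℂ, (∃ a b, p a ≠ p b) ∧
      (∀ j k, p j ≠ p k → x.1 j k = (labelCoord p).1 j k) ∧
      (∀ j k l, p j ≠ p k ∨ p j ≠ p l → x.2 j k l = (labelCoord p).2 j k l) := by
  have hx' : x ∈ closure (labelCoord '' normalized ι) := by
    refine closure_mono ?_ hx
    rintro _ ⟨z, hz, rfl⟩
    obtain ⟨w, hw, hwz⟩ := exists_normalized hz
    exact ⟨w, hw, hwz⟩
  -- `labelCoord` is not continuous on all normalised families, so `x` need not be the coordinates
  -- of one. Along the filter that clusters at `p`, the coordinates tend to those of `x`, and those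
  -- that are continuous at `p` also tend to their value at `p`.
  have hF : (comap labelCoord (𝓝 x) ⊓ 𝓟 (normalized ι)).NeBot := by
    refine inf_principal_neBot_iff.2 fun U hU => ?_
    obtain ⟨t, ht, htU⟩ := mem_comap.1 hU
    obtain ⟨_, hyt, z, hz, rfl⟩ := mem_closure_iff_nhds.1 hx' t ht
    exact ⟨z, htU hyt, hz⟩
  obtain ⟨p, hp, hpF⟩ := isCompact_normalized ι (f := comap labelCoord (𝓝 x) ⊓ 𝓟 (normalized ι))
    inf_le_right
  have hG : (𝓝 p ⊓ (comap labelCoord (𝓝 x) ⊓ 𝓟 (normalized ι))).NeBot := hpF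
  have hGx : Tendsto labelCoord (𝓝 p ⊓ (comap labelCoord (𝓝 x) ⊓ 𝓟 (normalized ι))) (𝓝 x) :=
    tendsto_comap.mono_left (inf_le_right.trans inf_le_left)
  refine ⟨p, ?_, fun j k h => ?_, fun j k l h => ?_⟩
  · obtain ⟨a, ha⟩ := mem_iUnion.1 hp.1
    obtain ⟨b, hb⟩ := mem_iUnion.1 ha
    refine ⟨a, b, fun h => ?_⟩
    have := hb.2
    rw [← h, hb.1, norm_zero] at this
    exact zero_ne_one this
  · have hc : Continuous fun y : (ι → ι → ℂ) × (ι → ι → ι → ENNReal) => y.1 j k := by fun_prop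
    exact tendsto_nhds_unique ((hc.tendsto x).comp hGx)
      ((tendsto_labelCoord_fst h).mono_left inf_le_left)
  · have hc : Continuous fun y : (ι → ι → ℂ) × (ι → ι → ι → ENNReal) => y.2 j k l := by fun_prop
    exact tendsto_nhds_unique ((hc.tendsto x).comp hGx)
      ((tendsto_labelCoord_snd h).mono_left inf_le_left)

/-- These coordinates are `0/0` for every family of points, so no macroscopic configuration controls
them; they are constant on configurations, hence on the closure. -/
theorem diag_of_mem_closure {ι : Type} {x : (ι → ι → ℂ) × (ι → ι → ι → ENNReal)}
    (hx : x ∈ closure (labelCoord '' {z : ι → ℂ | Function.Injective z})) (j : ι) :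
    x.1 j j = 0 ∧ x.2 j j j = 0 := by
  have hcl : IsClosed {x : (ι → ι → ℂ) × (ι → ι → ι → ENNReal) | x.1 j j = 0 ∧ x.2 j j j = 0} :=
    (isClosed_eq (by fun_prop) continuous_const).inter
      (isClosed_eq (by fun_prop) continuous_const)
  refine closure_minimal ?_ hcl hx
  rintro _ ⟨z, -, rfl⟩
  simp [labelCoord]

end Labels

/-! ### Every point is an iterated composition, up to relabelling -/

section Index

variable {m n : ℕ}

theorem isInner_innerPos (i : Fin (m + 1)) (b : Fin (n + 1)) : IsInner i (innerPos i b) := by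
  unfold IsInner innerPos
  simp only
  omega

theorem inner_innerPos (i : Fin (m + 1)) (b : Fin (n + 1)) : inner i (innerPos i b) = b := by
  unfold inner innerPos
  ext
  simp only
  omega

theorem not_isInner_outerPos {i a : Fin (m + 1)} (ha : a ≠ i) :
    ¬ IsInner i (outerPos i a : Fin (m + n + 1)) := by
  have ha' : (a : ℕ) ≠ i := fun h => ha (Fin.ext h)
  unfold IsInner outerPos
  split_ifs <;> simp only <;> omega

theorem outer_outerPos {i a : Fin (m + 1)} (ha : a ≠ i) :
    outer i (outerPos i a : Fin (m + n + 1)) = a := by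
  have ha' : (a : ℕ) ≠ i := fun h => ha (Fin.ext h)
  unfold outer outerPos
  ext
  split_ifs <;> simp only at * <;> omega

end Index

/-- Labels with a distinguished subset `B`, labels of the subset and of the quotient by it being
enumerated, are enumerated as the inputs of a composite. -/
theorem exists_equiv_comp {ι : Type} {m n : ℕ} (B : Set ι) (r : ι) (hr : r ∈ B)
    (e₁ : {j // j ∉ B ∨ j = r} ≃ Fin (m + 1)) (e₂ : B ≃ Fin (n + 1)) :
    ∃ e : ι ≃ Fin (m + n + 1),
      (∀ j (hj : j ∈ B), e j = innerPos (e₁ ⟨r, Or.inr rfl⟩) (e₂ ⟨j, hj⟩)) ∧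
      (∀ j (hj : j ∉ B), e j = outerPos (e₁ ⟨r, Or.inr rfl⟩) (e₁ ⟨j, Or.inl hj⟩)) := by
  classical
  set i := e₁ ⟨r, Or.inr rfl⟩ with hi
  have hne : ∀ j (hj : j ∉ B), e₁ ⟨j, Or.inl hj⟩ ≠ i := by
    intro j hj h
    have := congrArg Subtype.val (e₁.injective h)
    simp only at this
    exact hj (this ▸ hr)
  let f : ι → Fin (m + n + 1) := fun j =>
    if hj : j ∈ B then innerPos i (e₂ ⟨j, hj⟩) else outerPos i (e₁ ⟨j, Or.inl hj⟩)
  have f1 : ∀ j (hj : j ∈ B), f j = innerPos i (e₂ ⟨j, hj⟩) := fun j hj => dif_pos hj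
  have f2 : ∀ j (hj : j ∉ B), f j = outerPos i (e₁ ⟨j, Or.inl hj⟩) := fun j hj => dif_neg hj
  have hf : Function.Bijective f := by
    constructor
    · intro j k h
      by_cases hj : j ∈ B <;> by_cases hk : k ∈ B
      · rw [f1 j hj, f1 k hk] at h
        exact congrArg Subtype.val (e₂.injective (innerPos_inj h))
      · rw [f1 j hj, f2 k hk] at h
        exact absurd h (innerPos_ne_outerPos (hne k hk) _)
      · rw [f2 j hj, f1 k hk] at h
        exact absurd h.symm (innerPos_ne_outerPos (hne j hj) _)
      · rw [f2 j hj, f2 k hk] at h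
        exact congrArg Subtype.val (e₁.injective (outerPos_inj h))
    · intro k
      rcases pos_cases i k with ⟨b, rfl⟩ | ⟨a, ha, rfl⟩
      · exact ⟨e₂.symm b, by rw [f1 _ (e₂.symm b).2]; simp⟩
      · have hm : ((e₁.symm a : {j // j ∉ B ∨ j = r}) : ι) ∉ B := by
          refine (e₁.symm a).2.resolve_right fun h => ha ?_
          exact (e₁.symm_apply_eq).1 (Subtype.ext h)
        exact ⟨e₁.symm a, by rw [f2 _ hm]; simp⟩
  exact ⟨Equiv.ofBijective f hf, f1, f2⟩

/-- Labels range over arbitrary finite types so that the induction can pass to subsets without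
ordering them. The final enumeration `e` puts the labels of each inserted configuration in
consecutive positions; this is the source of the relabelling. -/
theorem exists_confTree (n : ℕ) : ∀ (ι : Type) [Fintype ι], Fintype.card ι = n + 1 →
    ∀ x ∈ closure (labelCoord '' {z : ι → ℂ | Function.Injective z}),
      ∃ (T : ConfTree n) (e : ι ≃ Fin (n + 1)), x = pullCoord e T.toMbar.1 := by
  classical
  induction n using Nat.strong_induction_on with
  | _ N ih =>
  intro ι _ hcard x hx
  have open_case : ∀ p : ι → ℂ, Function.Injective p →
      (∀ j k, j ≠ k → x.1 j k = (labelCoord p).1 j k) →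
      (∀ j k l, j ≠ k ∨ j ≠ l → x.2 j k l = (labelCoord p).2 j k l) →
      ∃ (T : ConfTree N) (e : ι ≃ Fin (N + 1)), x = pullCoord e T.toMbar.1 := by
    intro p hp h1 h2
    let e := Fintype.equivFinOfCardEq hcard
    refine ⟨.conf ⟨fun j => p (e.symm j), hp.comp e.symm.injective⟩, e, ?_⟩
    have hd := diag_of_mem_closure hx
    have hxp : x = labelCoord p := by
      refine Prod.ext ?_ ?_
      · funext j k
        by_cases hjk : j = k
        · subst hjk
          simp [(hd j).1, labelCoord]
        · exact h1 j k hjk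
      · funext j k l
        by_cases hjk : j = k ∧ j = l
        · obtain ⟨rfl, rfl⟩ := hjk
          simp [(hd j).2, labelCoord]
        · exact h2 j k l (by tauto)
    rw [hxp]
    simp [pullCoord, ConfTree.toMbar, Mbar.of, coord, labelCoord]
  rcases subsingleton_or_nontrivial ι with hι | hι
  -- A single label admits no nonconstant `p`; any point of the plane serves as the configuration.
  · refine open_case (fun _ => 0) (fun j k _ => Subsingleton.elim j k)
      (fun j k h => absurd (Subsingleton.elim j k) h) fun j k l h => ?_
    exact h.elim (absurd (Subsingleton.elim j k)) (absurd (Subsingleton.elim j l))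
  obtain ⟨p, ⟨a, b, hab⟩, h1, h2⟩ := exists_macroscopic hx
  by_cases hp : Function.Injective p
  · exact open_case p hp (fun j k h => h1 j k (hp.ne h))
      fun j k l h => h2 j k l (h.imp hp.ne hp.ne)
  obtain ⟨r, s, hrs, hne⟩ : ∃ r s, p r = p s ∧ r ≠ s := by
    simpa [Function.Injective] using hp
  set B : Set ι := {j | p j = p r} with hB
  have hrB : r ∈ B := rfl
  obtain ⟨q, hq⟩ : ∃ q, q ∉ B := by
    by_contra! hcon
    exact hab ((hcon a).trans (hcon b).symm)
  have hBpos : 1 < Fintype.card B :=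
    Fintype.one_lt_card_iff.2 ⟨⟨r, hrB⟩, ⟨s, hrs.symm⟩, fun h => hne (congrArg Subtype.val h)⟩
  have hQpos : 1 < Fintype.card {j // j ∉ B ∨ j = r} :=
    Fintype.one_lt_card_iff.2 ⟨⟨r, Or.inr rfl⟩, ⟨q, Or.inl hq⟩,
      fun h => hq (by have := congrArg Subtype.val h; simp only at this; exact this ▸ hrB)⟩
  obtain ⟨n, hn⟩ : ∃ n, Fintype.card B = n + 1 := ⟨Fintype.card B - 1, by omega⟩
  obtain ⟨m, hm⟩ : ∃ m, Fintype.card {j // j ∉ B ∨ j = r} = m + 1 :=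
    ⟨Fintype.card {j // j ∉ B ∨ j = r} - 1, by omega⟩
  obtain rfl : N = m + n := by
    obtain ⟨e, -⟩ := exists_equiv_comp B r hrB (Fintype.equivFinOfCardEq hm)
      (Fintype.equivFinOfCardEq hn)
    have := Fintype.card_congr e
    rw [Fintype.card_fin] at this
    omega
  -- Both `B` and its quotient, represented by the complement of `B` with `r` added, have at least
  -- two labels, so `m` and `n` are positive and less than `m + n`.
  obtain ⟨S, e₁, hS⟩ := ih m (by omega) {j // j ∉ B ∨ j = r} hm
    (pullCoord Subtype.val x) (pullCoord_mem_closure Subtype.val_injective hx)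
  obtain ⟨T, e₂, hT⟩ := ih n (by omega) B hn
    (pullCoord Subtype.val x) (pullCoord_mem_closure Subtype.val_injective hx)
  obtain ⟨e, he1, he2⟩ := exists_equiv_comp B r hrB e₁ e₂
  set i := e₁ ⟨r, Or.inr rfl⟩ with hi
  -- `c` collapses `B` to its representative `r`. It preserves `p`, hence all coordinates that `p`
  -- determines.
  let c : ι → {j // j ∉ B ∨ j = r} := fun j =>
    if hj : j ∈ B then ⟨r, Or.inr rfl⟩ else ⟨j, Or.inl hj⟩
  have c1 : ∀ j, j ∈ B → c j = ⟨r, Or.inr rfl⟩ := fun j hj => dif_pos hj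
  have c2 : ∀ j (hj : j ∉ B), c j = ⟨j, Or.inl hj⟩ := fun j hj => dif_neg hj
  have hpc : ∀ j, p (c j) = p j := by
    intro j
    by_cases hj : j ∈ B
    · rw [c1 j hj]; exact hj.symm
    · rw [c2 j hj]
  have hne' : ∀ j (hj : j ∉ B), e₁ ⟨j, Or.inl hj⟩ ≠ i := by
    intro j hj h
    have := congrArg Subtype.val (e₁.injective h)
    simp only at this
    exact hj (this ▸ hrB)
  have hIn : ∀ j, IsInner i (e j) ↔ j ∈ B := by
    intro j
    by_cases hj : j ∈ B
    · rw [he1 j hj]; exact iff_of_true (isInner_innerPos _ _) hj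
    · rw [he2 j hj]; exact iff_of_false (not_isInner_outerPos (hne' j hj)) hj
  have hOut : ∀ j, outer i (e j) = e₁ (c j) := by
    intro j
    by_cases hj : j ∈ B
    · rw [c1 j hj, outer_eq_of_isInner ((hIn j).2 hj)]
    · rw [he2 j hj, c2 j hj, outer_outerPos (hne' j hj)]
  have hInn : ∀ j (hj : j ∈ B), inner i (e j) = e₂ ⟨j, hj⟩ := by
    intro j hj
    rw [he1 j hj, inner_innerPos]
  refine ⟨.comp i S T, e, Prod.ext ?_ ?_⟩
  · funext j k
    simp only [pullCoord, ConfTree.toMbar, Mbar.comp, Coord.comp, hIn, hOut]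
    split_ifs with h
    · rw [hInn j h.1, hInn k h.2]
      exact congrFun (congrFun (congrArg Prod.fst hT) ⟨j, h.1⟩) ⟨k, h.2⟩
    · have := congrFun (congrFun (congrArg Prod.fst hS) (c j)) (c k)
      refine Eq.trans ?_ this
      simp only [pullCoord]
      -- As `B` is a whole fibre, labels with equal `p` that are not both in `B` are both outside it
      -- and are fixed by `c`. If `p` differs, it determines the coordinate.
      by_cases hjk : p j = p k
      · have hj : j ∉ B := fun hj => h ⟨hj, hjk.symm.trans hj⟩
        have hk : k ∉ B := fun hk => h ⟨hjk.trans hk, hk⟩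
        rw [c2 j hj, c2 k hk]
      · rw [h1 j k hjk, h1 (c j) (c k) (by rwa [hpc, hpc])]
        simp only [labelCoord, hpc]
  · funext j k l
    simp only [pullCoord, ConfTree.toMbar, Mbar.comp, Coord.comp, hIn, hOut]
    split_ifs with h
    · rw [hInn j h.1, hInn k h.2.1, hInn l h.2.2]
      exact congrFun (congrFun (congrFun (congrArg Prod.snd hT) ⟨j, h.1⟩) ⟨k, h.2.1⟩) ⟨l, h.2.2⟩
    · have := congrFun (congrFun (congrFun (congrArg Prod.snd hS) (c j)) (c k)) (c l)
      refine Eq.trans ?_ this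
      simp only [pullCoord]
      by_cases hjk : p j = p k ∧ p j = p l
      · have hj : j ∉ B := fun hj => h ⟨hj, hjk.1.symm.trans hj, hjk.2.symm.trans hj⟩
        have hk : k ∉ B := fun hk => hj (hjk.1.trans hk)
        have hl : l ∉ B := fun hl => hj (hjk.2.trans hl)
        rw [c2 j hj, c2 k hk, c2 l hl]
      · have hjk' : p j ≠ p k ∨ p j ≠ p l := by tauto
        rw [h2 j k l hjk', h2 (c j) (c k) (c l) (by rwa [hpc, hpc, hpc])]
        simp only [labelCoord, hpc]

/-- Every point of the compactification is, up to relabelling, an iterated composition of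
configurations. -/
theorem Mbar.exists_relabel_toMbar {n : ℕ} (x : Mbar n) :
    ∃ (T : ConfTree n) (σ : Equiv.Perm (Fin (n + 1))), x = Mbar.relabel σ T.toMbar := by
  obtain ⟨T, e, h⟩ := exists_confTree n (Fin (n + 1)) (Fintype.card_fin _) x.1 x.2
  exact ⟨T, e, Subtype.ext h⟩

/-! ### Extension by limits -/

theorem Mbar.denseRange_of (n : ℕ) : DenseRange (Mbar.of (n := n)) := by
  intro x
  rw [closure_subtype]
  refine closure_mono ?_ x.2
  rintro _ ⟨z, hz, rfl⟩
  exact ⟨Mbar.of ⟨z, hz⟩, ⟨_, rfl⟩, rfl⟩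

theorem _root_.DenseRange.neBot_comap_nhds {X Y : Type*} [TopologicalSpace Y] {i : X → Y}
    (hi : DenseRange i) (y : Y) : (comap i (𝓝 y)).NeBot := by
  refine comap_neBot fun t ht => ?_
  obtain ⟨_, hyt, z, rfl⟩ := mem_closure_iff_nhds.1 (hi y) t ht
  exact ⟨z, hyt⟩

instance Mbar.comap_of_neBot {n : ℕ} (x : Mbar n) : (comap Mbar.of (𝓝 x)).NeBot :=
  (Mbar.denseRange_of n).neBot_comap_nhds x

/-- A function with limits, along a map with dense range, at all points has a continuous
limit function. -/
theorem continuous_of_tendsto_comap {X Y Z : Type*} [TopologicalSpace Y] [TopologicalSpace Z]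
    [RegularSpace Z] {i : X → Y} (hi : DenseRange i) {φ : X → Z} {g : Y → Z}
    (h : ∀ y, Tendsto φ (comap i (𝓝 y)) (𝓝 (g y))) : Continuous g := by
  refine continuous_iff_continuousAt.2 fun y => ?_
  -- By regularity closed neighbourhoods `W` suffice. If `φ` lies in `W` near `y`, its limits at
  -- nearby points stay in `W`.
  refine (closed_nhds_basis (g y)).tendsto_right_iff.2 fun W hW => ?_
  obtain ⟨U, hU, hUW⟩ := mem_comap.1 (h y hW.1)
  filter_upwards [eventually_mem_nhds_iff.2 hU] with y' hy'
  have : (comap i (𝓝 y')).NeBot := hi.neBot_comap_nhds y'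
  exact hW.2.mem_of_tendsto (h y') (mem_of_superset (preimage_mem_comap hy') hUW)

theorem Mbar.continuous_relabel {n : ℕ} (σ : Equiv.Perm (Fin (n + 1))) :
    Continuous (Mbar.relabel σ) :=
  ((Coord.continuous_relabel σ).comp continuous_subtype_val).subtype_mk _

theorem Mbar.continuous_comp {m n : ℕ} (i : Fin (m + 1)) :
    Continuous (fun q : Mbar m × Mbar n => Mbar.comp i q.1 q.2) :=
  ((Coord.continuous_comp i).comp ((continuous_subtype_val.comp continuous_fst).prodMk
    (continuous_subtype_val.comp continuous_snd))).subtype_mk _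

theorem Mbar.of_affine {n : ℕ} (a : ℝ) (ha : 0 < a) (b : ℂ) (z : Conf n) :
    Mbar.of (Conf.affine a ha b z) = Mbar.of z :=
  Subtype.ext (labelCoord_affine ha b z.1)

/-! ### Passing between algebras and reduced conformal field theories -/

section Theories

variable {𝕜 : Type*} [RCLike 𝕜] {V : Type*} [AddCommGroup V] [Module 𝕜 V] [TopologicalSpace V]

theorem MultiHom.continuous_iff {X : Type*} [TopologicalSpace X] {n : ℕ} {f : X → MultiHom 𝕜 V n} :
    Continuous f ↔ ∀ v, Continuous fun x => f x v :=
  continuous_induced_rng.trans continuous_pi_iff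

theorem MultiHom.continuous_apply {n : ℕ} (f : MultiHom 𝕜 V n) :
    Continuous fun v : Fin (n + 1) → V => f v :=
  ContinuousMultilinearMap.cont (R := 𝕜) (M₁ := fun _ : Fin (n + 1) => V) (M₂ := V) f

theorem MultiHom.comp_apply {m n : ℕ} (i : Fin (m + 1)) (f : MultiHom 𝕜 V m) (g : MultiHom 𝕜 V n)
    (v : Fin (m + n + 1) → V) : MultiHom.comp i f g v = f (compArgs i g v) := rfl

theorem MultiHom.ext {n : ℕ} {f g : MultiHom 𝕜 V n} (h : ∀ v, f v = g v) : f = g :=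
  DFunLike.ext f g h

/-- Permutation of the arguments. -/
theorem MultiHom.exists_permute {n : ℕ} (σ : Equiv.Perm (Fin (n + 1))) (f : MultiHom 𝕜 V n) :
    ∃ g : MultiHom 𝕜 V n, ∀ v, g v = f fun j => v (σ j) :=
  ⟨ContinuousMultilinearMap.domDomCongr (R := 𝕜) (M₂ := V) (M₃ := V) σ f, fun _ => rfl⟩

variable [IsTopologicalAddGroup V] [ContinuousSMul 𝕜 V]

theorem IsNonunitalMbarAlgebra.toMbar_eq {A : (n : ℕ) → Mbar n → MultiHom 𝕜 V n}
    (hA : IsNonunitalMbarAlgebra A) {n : ℕ} (T : ConfTree n) :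
    A n T.toMbar = T.eval (restrict A) := by
  induction T with
  | conf z => rfl
  | comp i S T hS hT => rw [ConfTree.toMbar, hA.map_comp, hS, hT]; rfl

theorem IsNonunitalMbarAlgebra.isReducedCFT {A : (n : ℕ) → Mbar n → MultiHom 𝕜 V n}
    (hA : IsNonunitalMbarAlgebra A) : IsReducedCFT (restrict A) where
  smooth := hA.smooth
  equivariant n σ z v := hA.equivariant n σ (Mbar.of z) v
  invariant n a ha b z := by simp only [restrict, Mbar.of_affine]
  limit n T v := by
    rw [← hA.toMbar_eq]
    exact ((MultiHom.continuous_iff.1 (hA.continuous n) v).tendsto _).comp tendsto_comap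

/-- The limit axiom covers iterated compositions, whose labels are in consecutive order;
equivariance carries the limit to their relabellings. -/
theorem IsReducedCFT.exists_limit {Ψ : (n : ℕ) → Conf n → MultiHom 𝕜 V n}
    (hΨ : IsReducedCFT Ψ) {n : ℕ} (x : Mbar n) :
    ∃ f : MultiHom 𝕜 V n, ∀ v,
      Tendsto (fun z : Conf n => Ψ n z v) (comap Mbar.of (𝓝 x)) (𝓝 (f v)) := by
  obtain ⟨T, σ, rfl⟩ := x.exists_relabel_toMbar
  obtain ⟨f, hf⟩ := MultiHom.exists_permute σ.symm (T.eval Ψ)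
  refine ⟨f, fun v => ?_⟩
  have hT : Mbar.relabel σ.symm (Mbar.relabel σ T.toMbar) = T.toMbar := by
    refine Subtype.ext ?_
    simp [Mbar.relabel, Coord.relabel]
  have h1 : Tendsto (Conf.relabel σ.symm) (comap Mbar.of (𝓝 (Mbar.relabel σ T.toMbar)))
      (comap Mbar.of (𝓝 T.toMbar)) := by
    refine tendsto_comap_iff.2 ?_
    have := ((Mbar.continuous_relabel σ.symm).tendsto (Mbar.relabel σ T.toMbar)).comp
      (tendsto_comap (f := Mbar.of))
    rwa [hT] at this
  rw [hf]
  exact ((hΨ.limit n T fun j => v (σ.symm j)).comp h1).congr fun z =>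
    hΨ.equivariant n σ.symm z v

variable [T2Space V]

theorem IsReducedCFT.exists_algebra {Ψ : (n : ℕ) → Conf n → MultiHom 𝕜 V n}
    (hΨ : IsReducedCFT Ψ) :
    ∃ A : (n : ℕ) → Mbar n → MultiHom 𝕜 V n, IsNonunitalMbarAlgebra A ∧ restrict A = Ψ := by
  choose A hA using fun n (x : Mbar n) => hΨ.exists_limit x
  -- By uniqueness of limits the value does not depend on the tree that represents the point.
  have hT : ∀ {n : ℕ} (T : ConfTree n), A n T.toMbar = T.eval Ψ := fun T =>
    MultiHom.ext fun v => tendsto_nhds_unique (hA _ T.toMbar v) (hΨ.limit _ T v)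
  have hof : ∀ {n : ℕ} (z : Conf n), A n (Mbar.of z) = Ψ n z := fun z => hT (.conf z)
  have hc : ∀ n v, Continuous fun x => A n x v := fun n v =>
    continuous_of_tendsto_comap (Mbar.denseRange_of n) fun x => hA n x v
  refine ⟨A, ⟨fun n => MultiHom.continuous_iff.2 (hc n), fun n => ?_, fun n σ x v => ?_,
    fun m n i x y => MultiHom.ext fun v => ?_⟩, ?_⟩
  · simp only [hof]
    exact hΨ.smooth n
  · refine congrFun ((Mbar.denseRange_of n).equalizer
      ((hc n fun j => v (σ j)).comp (Mbar.continuous_relabel σ)) (hc n v) (funext fun z => ?_)) x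
    change A n (Mbar.of (Conf.relabel σ z)) _ = A n (Mbar.of z) v
    rw [hof, hof, hΨ.equivariant]
  -- Composition of operators need not be jointly continuous for pointwise convergence, so the
  -- identity is extended one variable at a time. First `x` is a configuration and `y` varies: the
  -- fixed operator `A m (Mbar.of z)` is continuous in its arguments.
  · have hright : ∀ (z : Conf m) (y : Mbar n), A (m + n) (Mbar.comp i (Mbar.of z) y) v =
        A m (Mbar.of z) (compArgs i (A n y) v) := by
      intro z y
      refine congrFun ((Mbar.denseRange_of n).equalizer
        (g := fun y => A (m + n) (Mbar.comp i (Mbar.of z) y) v)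
        (h := fun y => A m (Mbar.of z) (compArgs i (A n y) v)) ?_ ?_ (funext fun w => ?_)) y
      · exact (hc _ v).comp ((Mbar.continuous_comp i).comp (Continuous.prodMk_right _))
      · refine (MultiHom.continuous_apply _).comp (continuous_pi fun a => ?_)
        unfold compArgs
        split_ifs
        · exact hc n _
        · exact continuous_const
      · have := hT (.comp i (.conf z) (.conf w))
        simp only [ConfTree.toMbar, ConfTree.eval] at this
        simp only [Function.comp, this, hof, MultiHom.comp_apply]
    -- Now `y` is fixed, and so are the arguments of `A m x`; pointwise continuity in `x` is enough.
    refine congrFun ((Mbar.denseRange_of m).equalizer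
      (g := fun x => A (m + n) (Mbar.comp i x y) v)
      (h := fun x => A m x (compArgs i (A n y) v)) ?_ (hc m _) (funext fun z => hright z y)) x
    exact (hc _ v).comp ((Mbar.continuous_comp i).comp (Continuous.prodMk_left y))
  · funext n z
    exact hof z

theorem injOn_restrict :
    Set.InjOn restrict {A : (n : ℕ) → Mbar n → MultiHom 𝕜 V n | IsNonunitalMbarAlgebra A} := by
  intro A hA B hB h
  funext n x
  refine MultiHom.ext fun v => congrFun ((Mbar.denseRange_of n).equalizer
    (MultiHom.continuous_iff.1 (hA.continuous n) v)
    (MultiHom.continuous_iff.1 (hB.continuous n) v) (funext fun z => ?_)) x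
  exact congrArg (fun f : MultiHom 𝕜 V n => f v) (congrFun (congrFun h n) z)

/-- With a single label every coordinate is diagonal, hence `0`. So unitality on all one-point
configurations is the unit axiom. -/
theorem Mbar.of_eq_unit (z : Conf 0) : Mbar.of z = Mbar.unit := by
  refine Subtype.ext ?_
  have : ∀ j k : Fin 1, j = k := fun j k => Subsingleton.elim j k
  refine Prod.ext (funext fun j => funext fun k => ?_)
    (funext fun j => funext fun k => funext fun l => ?_)
  · obtain rfl := this j k
    simp [Mbar.of, Mbar.unit, coord]
  · obtain rfl := this j k
    simp [Mbar.of, Mbar.unit, coord]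

end Theories

end ConfOperad

end

theorem mainTheorem7 {𝕜 : Type*} [RCLike 𝕜] {V : Type*} [AddCommGroup V] [Module 𝕜 V]
    [TopologicalSpace V] [IsTopologicalAddGroup V] [ContinuousSMul 𝕜 V] [T2Space V] :
    Set.BijOn ConfOperad.restrict
      {A : (n : ℕ) → ConfOperad.Mbar n → ConfOperad.MultiHom 𝕜 V n |
        ConfOperad.IsMbarAlgebra A}
      {Ψ : (n : ℕ) → ConfOperad.Conf n → ConfOperad.MultiHom 𝕜 V n |
        ConfOperad.IsReducedCFT Ψ ∧ ∀ (z : ConfOperad.Conf 0) (v : Fin 1 → V), Ψ 0 z v = v 0} ∧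
    Set.BijOn ConfOperad.restrict
      {A : (n : ℕ) → ConfOperad.Mbar n → ConfOperad.MultiHom 𝕜 V n |
        ConfOperad.IsNonunitalMbarAlgebra A}
      {Ψ : (n : ℕ) → ConfOperad.Conf n → ConfOperad.MultiHom 𝕜 V n |
        ConfOperad.IsReducedCFT Ψ} := by
  refine ⟨⟨fun A hA => ⟨hA.toIsNonunitalMbarAlgebra.isReducedCFT, fun z v => ?_⟩, ?_,
    fun Ψ hΨ => ?_⟩, fun A hA => hA.isReducedCFT, ConfOperad.injOn_restrict, fun Ψ hΨ => ?_⟩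
  · rw [ConfOperad.restrict, ConfOperad.Mbar.of_eq_unit]
    exact hA.map_unit v
  · exact ConfOperad.injOn_restrict.mono fun A hA => hA.toIsNonunitalMbarAlgebra
  · obtain ⟨A, hA, rfl⟩ := hΨ.1.exists_algebra
    exact ⟨A, ⟨hA, fun v => hΨ.2 _ v⟩, rfl⟩
  · obtain ⟨A, hA, rfl⟩ := hΨ.exists_algebra
    exact ⟨A, hA, rfl⟩
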